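/- Let $H_1,H_2$ be complex Hilbert spaces, and let $\mathcal B(H,K)$ denote the bounded linear operators from $H$ to $K$. For $S\in\mathcal B(H,K)$ the minimum modulus is $m(S)=\inf\{\|Sx\| : x\in H,\ \|x\|=1\}$; $S$ is minimum attaining if $\|Sx_0\|=m(S)$ for some unit vector $x_0\in H$; and $S$ is absolutely minimum attaining ($\mathcal{AM}$) if the restriction $S|_M : M\to K$ is minimum attaining for every nonzero closed subspace $M$ of $H$. An operator $S\in\mathcal B(H,H)$ is Fredholm if its range is closed and the kernels of $S$ and $S^*$ are finite dimensional, and its essential spectrum is $\sigma_{ess}(S)=\{\mu\in\mathbb C : S-\mu I \text{ is not Fredholm}\}$. **Theorem.** Let $A_j\in\mathcal B(H_j,H_j)$ be positive ($j=1,2$), let $X\in\mathcal B(H_2,H_1)$, and suppose that the block operator $$T=\begin{bmatrix} A_1 & X\\ X^* & A_2\end{bmatrix}$$ is positive on the Hilbert space direct sum $H_1\oplus H_2$. If $A_1$ and $A_2$ are $\mathcal{AM}$, $\sigma_{ess}(A_1)=\sigma_{ess}(A_2)$, and $X$ has finite rank, then $T$ is $\mathcal{AM}$. -/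

import Mathlib

namespace BlockAM

noncomputable section

variable {H H₁ H₂ : Type*}
  [NormedAddCommGroup H] [InnerProductSpace ℂ H]
  [NormedAddCommGroup H₁] [InnerProductSpace ℂ H₁]
  [NormedAddCommGroup H₂] [InnerProductSpace ℂ H₂]

/-- The minimum modulus `m(T) = inf {‖T x‖ : ‖x‖ = 1}`. -/
def minModulus (T : H₁ →L[ℂ] H₂) : ℝ :=
  sInf {r : ℝ | ∃ x : H₁, ‖x‖ = 1 ∧ ‖T x‖ = r}

/-- `T` is minimum attaining: `‖T x₀‖ = m(T)` for some unit vector `x₀`. -/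
def IsMinAttaining (T : H₁ →L[ℂ] H₂) : Prop :=
  ∃ x : H₁, ‖x‖ = 1 ∧ ‖T x‖ = minModulus T

/-- `T` is absolutely minimum attaining (an AM operator): the restriction of `T` to every
nonzero closed subspace of `H₁` is minimum attaining. -/
def IsAM (T : H₁ →L[ℂ] H₂) : Prop :=
  ∀ M : Submodule ℂ H₁, IsClosed (M : Set H₁) → M ≠ ⊥ → IsMinAttaining (T ∘L M.subtypeL)

/-- The essential spectrum: all `μ` such that `T - μ I` is not Fredholm. -/
def essSpectrum (T : H →L[ℂ] H) : Set ℂ :=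
  {μ : ℂ | ¬ (T - μ • ContinuousLinearMap.id ℂ H).IsFredholm}

/-- `T` has finite rank: its range is finite dimensional. -/
def IsFiniteRank (T : H₁ →L[ℂ] H₂) : Prop :=
  FiniteDimensional ℂ T.range

/-- The block operator with rows `(A, B)` and `(C, D)` on the Hilbert space direct sum
`H₁ ⊕ H₂`, that is `(x, y) ↦ (A x + B y, C x + D y)`. -/
def blockOp (A : H₁ →L[ℂ] H₁) (B : H₂ →L[ℂ] H₁) (C : H₁ →L[ℂ] H₂) (D : H₂ →L[ℂ] H₂) :
    WithLp 2 (H₁ × H₂) →L[ℂ] WithLp 2 (H₁ × H₂) :=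
  ((WithLp.prodContinuousLinearEquiv 2 ℂ H₁ H₂).symm : H₁ × H₂ →L[ℂ] WithLp 2 (H₁ × H₂)) ∘L
    ((A.coprod B).prod (C.coprod D)) ∘L
      (WithLp.prodContinuousLinearEquiv 2 ℂ H₁ H₂ : WithLp 2 (H₁ × H₂) →L[ℂ] H₁ × H₂)

theorem blockOp_apply (A : H₁ →L[ℂ] H₁) (B : H₂ →L[ℂ] H₁) (C : H₁ →L[ℂ] H₂)
    (D : H₂ →L[ℂ] H₂) (v : WithLp 2 (H₁ × H₂)) :
    blockOp A B C D v = WithLp.toLp 2 (A v.fst + B v.snd, C v.fst + D v.snd) := rfl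

/-- On Hilbert spaces, Mathlib's Fredholm operators are exactly the operators with closed range
such that the kernels of `T` and of its adjoint are finite dimensional. -/
theorem isFredholm_iff [CompleteSpace H₁] [CompleteSpace H₂] (T : H₁ →L[ℂ] H₂) :
    T.IsFredholm ↔ IsClosed (T.range : Set H₂) ∧ FiniteDimensional ℂ T.ker ∧
      FiniteDimensional ℂ (ContinuousLinearMap.adjoint T).ker := by
  have key : IsClosed (T.range : Set H₂) →
      (T.range.CoFG ↔ FiniteDimensional ℂ (ContinuousLinearMap.adjoint T).ker) := by
    intro hc
    have : CompleteSpace T.range := hc.completeSpace_coe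
    rw [← T.orthogonal_range]
    have e := Submodule.quotientEquivOfIsCompl T.range T.rangeᗮ
      (Submodule.isCompl_orthogonal T.range)
    exact ⟨fun h => Module.Finite.equiv e, fun h => Module.Finite.equiv e.symm⟩
  constructor
  · intro h
    exact ⟨h.isClosed_range, h.finite_ker, (key h.isClosed_range).1 h.finite_coker⟩
  · rintro ⟨hc, hk, ha⟩
    refine ⟨?_, hc, hk, (key hc).2 ha, ?_⟩
    · have : CompleteSpace T.range := hc.completeSpace_coe
      have hs : Function.Surjective T.rangeRestrict := LinearMap.surjective_rangeRestrict _
      exact (T : H₁ →ₗ[ℂ] H₂).isStrictMap_iff_isOpenQuotientMap_rangeRestrict.2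
        ⟨hs, T.rangeRestrict.continuous, T.rangeRestrict.isOpenMap hs⟩
    · exact Submodule.ClosedComplemented.of_finiteDimensional _

end

end BlockAM

namespace BlockAM

open scoped InnerProductSpace
open Filter Topology

variable {H H₁ H₂ : Type*}
  [NormedAddCommGroup H] [InnerProductSpace ℂ H]
  [NormedAddCommGroup H₁] [InnerProductSpace ℂ H₁]
  [NormedAddCommGroup H₂] [InnerProductSpace ℂ H₂]

/-! Call a subspace large if it contains the orthogonal complement of a finite-dimensional one.
`IsEssConst T a` says that ‖Tx‖²/‖x‖² is at most a on a large subspace and above a - δ on another,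
for each δ > 0. This implies AM (`IsEssConst.isAM`), and every AM operator on an
infinite-dimensional space has such an a (`IsAM.exists_isEssConst`). For positive A, √a is the only
real point of the essential spectrum, so equal essential spectra force a common a. On a large
subspace a finite-rank X disappears and the block operator is diagonal, so it inherits a and is AM.
-/

theorem minModulus_nonneg (T : H₁ →L[ℂ] H₂) : 0 ≤ minModulus T :=
  Real.sInf_nonneg (by rintro _ ⟨x, -, rfl⟩; exact norm_nonneg _)

theorem minModulus_sq_mul_le (T : H₁ →L[ℂ] H₂) (x : H₁) :
    minModulus T ^ 2 * ‖x‖ ^ 2 ≤ ‖T x‖ ^ 2 := by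
  rcases eq_or_ne x 0 with rfl | hx
  · simp
  have hx' : ‖x‖ ≠ 0 := norm_ne_zero_iff.2 hx
  have hbdd : BddBelow {r : ℝ | ∃ x : H₁, ‖x‖ = 1 ∧ ‖T x‖ = r} :=
    ⟨0, by rintro _ ⟨x, -, rfl⟩; positivity⟩
  have h := csInf_le hbdd ⟨(‖x‖⁻¹ : ℂ) • x, by simp [norm_smul, hx'], rfl⟩
  rw [← minModulus, map_smul, norm_smul, norm_inv, Complex.norm_real, norm_norm,
    le_inv_mul_iff₀ (by positivity)] at h
  rw [← mul_pow]
  exact pow_le_pow_left₀ (mul_nonneg (minModulus_nonneg T) (norm_nonneg _)) (by linarith) 2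

theorem isMinAttaining_iff (T : H₁ →L[ℂ] H₂) :
    IsMinAttaining T ↔ ∃ x : H₁, ‖x‖ = 1 ∧ ∀ y, ‖T x‖ ^ 2 * ‖y‖ ^ 2 ≤ ‖T y‖ ^ 2 := by
  constructor
  · rintro ⟨x, hx, hTx⟩
    exact ⟨x, hx, fun y => hTx ▸ minModulus_sq_mul_le T y⟩
  · rintro ⟨x, hx, h⟩
    refine ⟨x, hx, le_antisymm (le_csInf ⟨_, x, hx, rfl⟩ ?_) ?_⟩
    · rintro _ ⟨y, hy, rfl⟩
      have := h y
      rw [hy, one_pow, mul_one] at this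
      exact (sq_le_sq₀ (norm_nonneg _) (norm_nonneg _)).1 this
    · have := minModulus_sq_mul_le T x
      rw [hx, one_pow, mul_one] at this
      exact (sq_le_sq₀ (minModulus_nonneg T) (norm_nonneg _)).1 this

theorem IsAM.exists_min {T : H₁ →L[ℂ] H₂} (hT : IsAM T) {M : Submodule ℂ H₁}
    (hM : IsClosed (M : Set H₁)) (hne : M ≠ ⊥) :
    ∃ x ∈ M, ‖x‖ = 1 ∧ ∀ y ∈ M, ‖T x‖ ^ 2 * ‖y‖ ^ 2 ≤ ‖T y‖ ^ 2 := by
  obtain ⟨x, hx, h⟩ := (isMinAttaining_iff _).1 (hT M hM hne)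
  exact ⟨x, x.2, by simpa using hx, fun y hy => by simpa using h ⟨y, hy⟩⟩

theorem exists_unit_mem_orthogonal (hH : ¬ FiniteDimensional ℂ H) (F : Submodule ℂ H)
    [FiniteDimensional ℂ F] : ∃ x ∈ Fᗮ, ‖x‖ = 1 := by
  have hne : Fᗮ ≠ ⊥ := by
    intro h
    rw [Submodule.orthogonal_eq_bot_iff] at h
    subst h
    exact hH (Module.Finite.equiv (Submodule.topEquiv : _ ≃ₗ[ℂ] H))
  obtain ⟨x, hx, hx0⟩ := Submodule.exists_mem_ne_zero_of_ne_bot hne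
  exact ⟨(‖x‖⁻¹ : ℂ) • x, Submodule.smul_mem _ _ hx, by simp [norm_smul, hx0]⟩

/-- Lets conditions on large subspaces be pulled back along T: the preimage of a large subspace is
large. -/
theorem apply_mem_orthogonal [CompleteSpace H₁] [CompleteSpace H₂] (T : H₁ →L[ℂ] H₂)
    {F : Submodule ℂ H₂} {x : H₁}
    (hx : x ∈ (F.map (ContinuousLinearMap.adjoint T : H₂ →ₗ[ℂ] H₁))ᗮ) : T x ∈ Fᗮ := by
  rw [Submodule.mem_orthogonal] at hx ⊢
  intro u hu
  rw [← ContinuousLinearMap.adjoint_inner_left]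
  exact hx _ (Submodule.mem_map_of_mem hu)

/-! ### AM operators have an essential constant -/

/-- Up to finite-dimensional subspaces, `‖T x‖² / ‖x‖²` is at most `a` and arbitrarily close
to `a`. -/
def IsEssConst (T : H₁ →L[ℂ] H₂) (a : ℝ) : Prop :=
  (∀ δ > 0, ∃ F : Submodule ℂ H₁, FiniteDimensional ℂ F ∧
    ∀ x ∈ Fᗮ, (a - δ) * ‖x‖ ^ 2 ≤ ‖T x‖ ^ 2) ∧
  ∃ F : Submodule ℂ H₁, FiniteDimensional ℂ F ∧ ∀ x ∈ Fᗮ, ‖T x‖ ^ 2 ≤ a * ‖x‖ ^ 2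

theorem isEssConst_of_finiteDimensional [FiniteDimensional ℂ H₁] (T : H₁ →L[ℂ] H₂) (a : ℝ) :
    IsEssConst T a :=
  ⟨fun _ _ => ⟨⊤, inferInstance, by simp⟩, ⊤, inferInstance, by simp⟩

/-- An AM operator admits no sequence of unit vectors, orthogonal and with orthogonal images,
whose images have norms decreasing to a limit without reaching it. -/
theorem IsAM.not_seq [CompleteSpace H₁] {T : H₁ →L[ℂ] H₂} (hT : IsAM T) {a : ℝ} {x : ℕ → H₁}
    (hx : ∀ n, ‖x n‖ = 1) (horth : Pairwise fun i j => ⟪x i, x j⟫_ℂ = 0)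
    (hTorth : Pairwise fun i j => ⟪T (x i), T (x j)⟫_ℂ = 0)
    (hlt : ∀ n, a < ‖T (x n)‖ ^ 2)
    (hlim : ∀ ε > 0, ∃ n, ‖T (x n)‖ ^ 2 < a + ε) : False := by
  set M : Submodule ℂ H₁ := (Submodule.span ℂ (Set.range x)).topologicalClosure
  have hmem : ∀ n, x n ∈ M := fun n =>
    Submodule.le_topologicalClosure _ (Submodule.subset_span ⟨n, rfl⟩)
  have hne : M ≠ ⊥ := by
    intro h
    have h0 := hmem 0
    rw [h, Submodule.mem_bot] at h0
    simpa [h0] using hx 0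
  obtain ⟨z, hz, hz1, hmin⟩ := hT.exists_min (Submodule.isClosed_topologicalClosure _) hne
  have hza : ‖T z‖ ^ 2 ≤ a := by
    refine le_of_forall_pos_lt_add fun ε hε => ?_
    obtain ⟨n, hn⟩ := hlim ε hε
    have := hmin _ (hmem n)
    rw [hx n] at this
    linarith
  -- Both sides are continuous and linear in z and agree on every x j.
  have hinner : ∀ i, ⟪T (x i), T z⟫_ℂ = (‖T (x i)‖ ^ 2 : ℝ) * ⟪x i, z⟫_ℂ := by
    intro i
    let φ : H₁ →L[ℂ] ℂ :=
      (innerSL ℂ (T (x i))) ∘L T - ((‖T (x i)‖ ^ 2 : ℝ) : ℂ) • innerSL ℂ (x i)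
    have hle : M ≤ φ.ker := by
      refine Submodule.topologicalClosure_minimal _ ?_ φ.isClosed_ker
      rw [Submodule.span_le]
      rintro _ ⟨j, rfl⟩
      rcases eq_or_ne i j with rfl | hij
      · simp [φ, inner_self_eq_norm_sq_to_K, hx]
      · simp [φ, horth hij, hTorth hij]
    have := hle hz
    simpa [φ, sub_eq_zero] using this
  -- Removing the component c • x i lowers ‖z‖² by |c|² and ‖Tz‖² by ‖T (x i)‖²|c|². As ‖T (x i)‖² >
  -- a ≥ ‖Tz‖², the quotient would drop below its minimum unless c = 0.
  have hzero : ∀ i, ⟪x i, z⟫_ℂ = 0 := by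
    intro i
    set c := ⟪x i, z⟫_ℂ with hc
    have h1 := hmin (z - c • x i) (M.sub_mem hz (M.smul_mem _ (hmem i)))
    rw [map_sub, map_smul, @norm_sub_sq ℂ, @norm_sub_sq ℂ, inner_smul_right, inner_smul_right,
      ← inner_conj_symm (T z), hinner i, ← inner_conj_symm z, ← hc, norm_smul, norm_smul, hx i,
      hz1] at h1
    have e1 : RCLike.re (c * (starRingEnd ℂ) c) = ‖c‖ ^ 2 := by
      rw [RCLike.mul_conj]; norm_cast
    have e2 : RCLike.re (c * (starRingEnd ℂ) (((‖T (x i)‖ ^ 2 : ℝ) : ℂ) * c)) =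
        ‖T (x i)‖ ^ 2 * ‖c‖ ^ 2 := by
      have e3 : c * (starRingEnd ℂ) (((‖T (x i)‖ ^ 2 : ℝ) : ℂ) * c) =
          ((‖T (x i)‖ ^ 2 * ‖c‖ ^ 2 : ℝ) : ℂ) := by
        rw [map_mul, Complex.conj_ofReal, mul_left_comm, RCLike.mul_conj,
          Complex.ofReal_mul, Complex.ofReal_pow ‖c‖]
        rfl
      rw [e3]
      exact RCLike.ofReal_re (K := ℂ) _
    rw [e1, e2] at h1
    by_contra h
    have hpos : 0 < ‖c‖ ^ 2 := by positivity
    have := mul_pos (sub_pos.2 (hza.trans_lt (hlt i))) hpos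
    nlinarith
  have hMz : M ≤ (ℂ ∙ z)ᗮ := by
    refine Submodule.topologicalClosure_minimal _ ?_ (Submodule.isClosed_orthogonal _)
    rw [Submodule.span_le]
    rintro _ ⟨j, rfl⟩
    rw [SetLike.mem_coe, Submodule.mem_orthogonal_singleton_iff_inner_left]
    exact hzero j
  have := Submodule.mem_orthogonal_singleton_iff_inner_left.1 (hMz hz)
  rw [inner_self_eq_zero] at this
  simp [this] at hz1

/-- Without a gap, one could choose inductively the sequence excluded by `IsAM.not_seq`, at least
halving the excess over a each time. Orthogonality to the T*T-images of earlier vectors makes the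
images orthogonal. -/
theorem IsAM.exists_gap [CompleteSpace H₁] [CompleteSpace H₂] {T : H₁ →L[ℂ] H₂} (hT : IsAM T)
    (a : ℝ) : ∃ F : Submodule ℂ H₁, FiniteDimensional ℂ F ∧ ∃ ε > 0,
      ∀ x ∈ Fᗮ, ‖x‖ = 1 → a < ‖T x‖ ^ 2 → a + ε ≤ ‖T x‖ ^ 2 := by
  by_contra! hcon
  let S := ContinuousLinearMap.adjoint T ∘L T
  obtain ⟨x, hx, hxx⟩ := exists_seq_of_forall_finset_exists
    (fun x : H₁ => ‖x‖ = 1 ∧ a < ‖T x‖ ^ 2)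
    (fun x y => ⟪x, y⟫_ℂ = 0 ∧ ⟪T x, T y⟫_ℂ = 0 ∧ ‖T y‖ ^ 2 - a < (‖T x‖ ^ 2 - a) / 2) (by
      intro s hs
      have hε : ∃ ε > 0, ∀ x ∈ s, ε ≤ (‖T x‖ ^ 2 - a) / 2 := by
        rcases s.eq_empty_or_nonempty with rfl | hne
        · exact ⟨1, one_pos, by simp⟩
        obtain ⟨w, hw, hmin⟩ := s.exists_min_image (fun x => (‖T x‖ ^ 2 - a) / 2) hne
        exact ⟨_, by have := (hs w hw).2; linarith, hmin⟩
      obtain ⟨ε, hε, hεs⟩ := hε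
      obtain ⟨y, hy, hy1, hya, hyε⟩ := hcon
        (Submodule.span ℂ (s : Set H₁) ⊔ (Submodule.span ℂ (s : Set H₁)).map (S : H₁ →ₗ[ℂ] H₁))
        inferInstance ε hε
      rw [← Submodule.inf_orthogonal, Submodule.mem_inf, Submodule.mem_orthogonal,
        Submodule.mem_orthogonal] at hy
      refine ⟨y, ⟨hy1, hya⟩, fun x hxs => ⟨hy.1 _ (Submodule.subset_span hxs), ?_, ?_⟩⟩
      · rw [← ContinuousLinearMap.adjoint_inner_left]
        exact hy.2 _ (Submodule.mem_map_of_mem (Submodule.subset_span hxs))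
      · linarith [hεs x hxs])
  refine hT.not_seq (fun n => (hx n).1) ?_ ?_ (fun n => (hx n).2) (a := a) ?_
  · intro i j hij
    rcases hij.lt_or_gt with h | h
    · exact (hxx i j h).1
    · exact inner_eq_zero_symm.1 (hxx j i h).1
  · intro i j hij
    rcases hij.lt_or_gt with h | h
    · exact (hxx i j h).2.1
    · exact inner_eq_zero_symm.1 (hxx j i h).2.1
  · intro ε hε
    have hgeo : ∀ n, ‖T (x n)‖ ^ 2 - a ≤ (‖T (x 0)‖ ^ 2 - a) * (1 / 2) ^ n := by
      intro n
      induction n with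
      | zero => simp
      | succ n ih =>
        have := (hxx n (n + 1) n.lt_succ_self).2.2
        rw [pow_succ (1 / 2 : ℝ)]
        linarith
    have hpos := sub_pos.2 (hx 0).2
    obtain ⟨n, hn⟩ := exists_pow_lt_of_lt_one (div_pos hε hpos) (by norm_num : (1 / 2 : ℝ) < 1)
    rw [lt_div_iff₀ hpos] at hn
    exact ⟨n, by linarith [hgeo n]⟩

/-- The constant is the supremum of the lower bounds valid on large subspaces. On the unit sphere of
Fᗮ the values of ‖Tx‖² form an interval whose minimum is attained and is at most a, so they cannot
cross the gap above a. -/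
theorem IsAM.exists_isEssConst [CompleteSpace H₁] [CompleteSpace H₂] {T : H₁ →L[ℂ] H₂}
    (hT : IsAM T) (hH : ¬ FiniteDimensional ℂ H₁) : ∃ a, 0 ≤ a ∧ IsEssConst T a := by
  set R : Set ℝ := {r | ∃ F : Submodule ℂ H₁, FiniteDimensional ℂ F ∧
    ∀ x ∈ Fᗮ, r * ‖x‖ ^ 2 ≤ ‖T x‖ ^ 2}
  have h0 : (0 : ℝ) ∈ R := ⟨⊥, inferInstance, fun x _ => by rw [zero_mul]; positivity⟩
  have hbdd : BddAbove R := by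
    refine ⟨‖T‖ ^ 2, ?_⟩
    rintro r ⟨F, hF, h⟩
    obtain ⟨x, hx, hx1⟩ := exists_unit_mem_orthogonal hH F
    have h1 := h x hx
    have h2 := T.le_opNorm x
    rw [hx1, one_pow, mul_one] at h1
    rw [hx1, mul_one] at h2
    exact h1.trans (pow_le_pow_left₀ (norm_nonneg _) h2 2)
  refine ⟨sSup R, le_csSup hbdd h0, fun δ hδ => ?_, ?_⟩
  · obtain ⟨r, ⟨F, hF, h⟩, hr⟩ := exists_lt_of_lt_csSup ⟨0, h0⟩ (sub_lt_self (sSup R) hδ)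
    exact ⟨F, hF, fun x hx => (mul_le_mul_of_nonneg_right hr.le (by positivity)).trans (h x hx)⟩
  · obtain ⟨F, hF, ε, hε, hgap⟩ := hT.exists_gap (sSup R)
    refine ⟨F, hF, ?_⟩
    obtain ⟨x₁, hx₁, hx₁n⟩ := exists_unit_mem_orthogonal hH F
    have hne : Fᗮ ≠ ⊥ := by
      intro h
      rw [h, Submodule.mem_bot] at hx₁
      simp [hx₁] at hx₁n
    obtain ⟨x₀, hx₀, hx₀1, hmin⟩ := hT.exists_min (Submodule.isClosed_orthogonal F) hne
    have hx₀a : ‖T x₀‖ ^ 2 ≤ sSup R := le_csSup hbdd ⟨F, hF, hmin⟩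
    have : Nontrivial Fᗮ := (Submodule.nontrivial_iff_ne_bot).2 hne
    -- Real dimension at least 2 makes the unit sphere connected.
    have hrank : 1 < Module.rank ℝ Fᗮ := by
      rw [rank_real_of_complex]
      have : 1 ≤ Module.rank ℂ Fᗮ := Cardinal.one_le_iff_pos.2 rank_pos
      calc (1 : Cardinal) < 2 * 1 := by norm_num
        _ ≤ _ := by gcongr
    have hconn : IsPreconnected ((fun x : Fᗮ => ‖T x‖ ^ 2) '' Metric.sphere 0 1) :=
      (isPreconnected_sphere hrank 0 1).image _ (by fun_prop)
    have hunit : ∀ x ∈ Fᗮ, ‖x‖ = 1 → ‖T x‖ ^ 2 ≤ sSup R := by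
      intro x hx hx1
      by_contra! hlt
      have h := hgap x hx hx1 hlt
      obtain ⟨y, hy, hya⟩ := hconn.ordConnected.out
        (⟨⟨x₀, hx₀⟩, by simpa using hx₀1, rfl⟩) (⟨⟨x, hx⟩, by simpa using hx1, rfl⟩)
        (⟨by simp only; linarith, by simp only; linarith⟩ :
          sSup R + ε / 2 ∈ Set.Icc _ _)
      simp only at hya
      have := hgap y y.2 (by simpa using hy) (by linarith)
      linarith
    intro x hx
    rcases eq_or_ne x 0 with rfl | hx0
    · simp
    have hx' : ‖x‖ ≠ 0 := norm_ne_zero_iff.2 hx0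
    have h := hunit ((‖x‖⁻¹ : ℂ) • x) (Submodule.smul_mem _ _ hx) (by simp [norm_smul, hx'])
    rw [map_smul, norm_smul, norm_inv, Complex.norm_real, norm_norm, mul_pow, inv_pow,
      inv_mul_le_iff₀ (by positivity)] at h
    linarith

/-! ### An essential constant implies AM -/

/-- If `‖T x‖² / ‖x‖²` exceeds `m(T)²` by a fixed amount on the orthogonal complement of a
finite-dimensional subspace, then `T` is minimum attaining. -/
theorem isMinAttaining_of_gap [CompleteSpace H₁] [Nontrivial H₁] (T : H₁ →L[ℂ] H₂)
    (F : Submodule ℂ H₁) [FiniteDimensional ℂ F] {c : ℝ} (hc : 0 < c)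
    (hF : ∀ x ∈ Fᗮ, (minModulus T ^ 2 + c) * ‖x‖ ^ 2 ≤ ‖T x‖ ^ 2) : IsMinAttaining T := by
  set m := minModulus T
  have hne : {r : ℝ | ∃ x : H₁, ‖x‖ = 1 ∧ ‖T x‖ = r}.Nonempty := by
    obtain ⟨x, hx⟩ := exists_norm_eq H₁ zero_le_one
    exact ⟨_, x, hx, rfl⟩
  have hbdd : BddBelow {r : ℝ | ∃ x : H₁, ‖x‖ = 1 ∧ ‖T x‖ = r} :=
    ⟨0, by rintro _ ⟨x, -, rfl⟩; positivity⟩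
  obtain ⟨r, -, hr, hrmem⟩ := exists_seq_tendsto_sInf hne hbdd
  choose x hx1 hxr using hrmem
  have : ProperSpace F := FiniteDimensional.proper ℂ F
  obtain ⟨z, -, φ, hφ, hz⟩ := (isCompact_closedBall (0 : F) 1).tendsto_subseq
    (x := fun n => F.orthogonalProjectionOnto (x n)) (fun n => by
      rw [mem_closedBall_zero_iff, ← hx1 n]
      exact Submodule.norm_orthogonalProjectionOnto_apply_le F (x n))
  let d : H₁ → ℝ := fun v => ‖T v‖ ^ 2 - m ^ 2 * ‖v‖ ^ 2
  have hd0 : ∀ v, 0 ≤ d v := fun v => sub_nonneg.2 (minModulus_sq_mul_le T v)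
  -- Parallelogram law for the form d, with d (v + w) ≥ 0 dropped.
  have hdsub : ∀ v w, d (v - w) ≤ 2 * d v + 2 * d w := by
    intro v w
    have h1 := hd0 (v + w)
    have h2 := parallelogram_law_with_norm ℂ v w
    have h3 := parallelogram_law_with_norm ℂ (T v) (T w)
    simp only [d, map_add, map_sub] at h1 ⊢
    have h4 : ‖v - w‖ ^ 2 = 2 * (‖v‖ ^ 2 + ‖w‖ ^ 2) - ‖v + w‖ ^ 2 := by linarith
    have h5 : ‖T v - T w‖ ^ 2 = 2 * (‖T v‖ ^ 2 + ‖T w‖ ^ 2) - ‖T v + T w‖ ^ 2 := by linarith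
    rw [h4, h5]
    linarith
  have hdle : ∀ v, d v ≤ ‖T‖ ^ 2 * ‖v‖ ^ 2 := by
    intro v
    have h1 : ‖T v‖ ^ 2 ≤ (‖T‖ * ‖v‖) ^ 2 := pow_le_pow_left₀ (norm_nonneg _) (T.le_opNorm v) 2
    have h2 : 0 ≤ m ^ 2 * ‖v‖ ^ 2 := by positivity
    simp only [d]
    linarith [mul_pow ‖T‖ ‖v‖ 2]
  have hdx : Tendsto (fun n => d (x n)) atTop (𝓝 0) := by
    have h : Tendsto (fun n => r n ^ 2 - m ^ 2) atTop (𝓝 (m ^ 2 - m ^ 2)) :=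
      (hr.pow 2).sub_const _
    simpa [d, hx1, hxr] using h
  set w : ℕ → F := fun n => F.orthogonalProjectionOnto (x (φ n)) with hw
  -- With u and p the Fᗮ- and F-parts of the difference, c‖u‖² ≤ d u, and two uses of `hdsub` bound
  -- d u. Since d (x n) → 0 and the F-parts converge, the minimising subsequence is Cauchy.
  have hbound : ∀ i j, dist (x (φ i)) (x (φ j)) ^ 2 ≤
      (4 * d (x (φ i)) + 4 * d (x (φ j)) + 2 * ‖T‖ ^ 2 * dist (w i) (w j) ^ 2) / c +
        dist (w i) (w j) ^ 2 := by
    intro i j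
    set v := x (φ i) - x (φ j) with hv
    have hp : F.orthogonalProjectionOnto v = w i - w j := by simp [hv, hw]
    have hu : v - (w i - w j : F) ∈ Fᗮ := by
      rw [← hp]; exact Submodule.sub_starProjection_mem_orthogonal v
    have h1 := hF _ hu
    have h2 := hdsub v ((w i - w j : F) : H₁)
    have h3 := hdsub (x (φ i)) (x (φ j))
    have h4 := hdle ((w i - w j : F) : H₁)
    have h5 : ‖v‖ ^ 2 = ‖v - (w i - w j : F)‖ ^ 2 + ‖((w i - w j : F) : H₁)‖ ^ 2 := by
      have := norm_add_sq_eq_norm_sq_add_norm_sq_of_inner_eq_zero (𝕜 := ℂ) _ _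
        (Submodule.inner_left_of_mem_orthogonal (w i - w j).2 hu)
      simpa [sq] using this
    rw [dist_eq_norm, dist_eq_norm, ← hv, h5, ← Submodule.norm_coe]
    gcongr
    rw [le_div_iff₀ hc]
    simp only [d] at h1 h2 h3 h4 ⊢
    linarith
  have hcauchy : CauchySeq (fun n => x (φ n)) := by
    rw [cauchySeq_iff_tendsto_dist_atTop_0]
    have hwc := cauchySeq_iff_tendsto_dist_atTop_0.1 hz.cauchySeq
    have hdφ := hdx.comp hφ.tendsto_atTop
    rw [← prod_atTop_atTop_eq] at hwc ⊢
    have hlim := ((((hdφ.comp tendsto_fst).const_mul 4).add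
      ((hdφ.comp tendsto_snd).const_mul 4)).add ((hwc.pow 2).const_mul (2 * ‖T‖ ^ 2))).div_const c
        |>.add (hwc.pow 2) |>.sqrt
    simp only [mul_zero, add_zero, ne_eq, OfNat.ofNat_ne_zero, not_false_eq_true, zero_pow,
      zero_div, Real.sqrt_zero] at hlim
    exact squeeze_zero (fun _ => dist_nonneg) (fun p => Real.le_sqrt_of_sq_le (hbound p.1 p.2)) hlim
  obtain ⟨y, hy⟩ := cauchySeq_tendsto_of_complete hcauchy
  refine ⟨y, tendsto_nhds_unique hy.norm (by simp [hx1]), ?_⟩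
  refine tendsto_nhds_unique ((T.continuous.tendsto y).comp hy).norm ?_
  simpa [Function.comp_def, hxr, minModulus] using hr.comp hφ.tendsto_atTop

/-- In infinite dimension m(T)² ≤ a. If equal, any unit vector of the large subspace with upper
bound a attains m(T); if not, δ = (a - m(T)²)/2 leaves the gap c = δ. -/
theorem IsEssConst.isMinAttaining [CompleteSpace H₁] [Nontrivial H₁] {T : H₁ →L[ℂ] H₂} {a : ℝ}
    (h : IsEssConst T a) : IsMinAttaining T := by
  by_cases hfin : FiniteDimensional ℂ H₁
  · exact isMinAttaining_of_gap T ⊤ one_pos (by simp)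
  obtain ⟨F, hF, hFa⟩ := h.2
  obtain ⟨x, hx, hx1⟩ := exists_unit_mem_orthogonal hfin F
  have h1 := minModulus_sq_mul_le T x
  have h2 := hFa x hx
  rw [hx1, one_pow, mul_one] at h1 h2
  rcases (h1.trans h2).eq_or_lt with heq | hlt
  · refine ⟨x, hx1, ?_⟩
    rw [← sq_eq_sq₀ (norm_nonneg _) (minModulus_nonneg T)]
    linarith
  · obtain ⟨G, hG, hGa⟩ := h.1 ((a - minModulus T ^ 2) / 2) (by linarith)
    refine isMinAttaining_of_gap T G (c := (a - minModulus T ^ 2) / 2) (by linarith) fun y hy => ?_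
    convert hGa y hy using 2
    ring

theorem IsEssConst.isAM [CompleteSpace H₁] {T : H₁ →L[ℂ] H₂} {a : ℝ} (h : IsEssConst T a) :
    IsAM T := by
  intro M hM hne
  have : CompleteSpace M := hM.completeSpace_coe
  have : Nontrivial M := Submodule.nontrivial_iff_ne_bot.2 hne
  refine IsEssConst.isMinAttaining (a := a) ⟨fun δ hδ => ?_, ?_⟩
  · obtain ⟨F, hF, hFa⟩ := h.1 δ hδ
    exact ⟨F.map (ContinuousLinearMap.adjoint M.subtypeL : H₁ →ₗ[ℂ] M), inferInstance,
      fun x hx => hFa _ (apply_mem_orthogonal M.subtypeL hx)⟩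
  · obtain ⟨F, hF, hFa⟩ := h.2
    exact ⟨F.map (ContinuousLinearMap.adjoint M.subtypeL : H₁ →ₗ[ℂ] M), inferInstance,
      fun x hx => hFa _ (apply_mem_orthogonal M.subtypeL hx)⟩

/-! ### Removing the finite-rank off-diagonal part -/

/-- X* vanishes on (range X)ᗮ. If y ⟂ X*(range X), then Xy lies in range X and in its complement, so
Xy = 0. -/
theorem exists_blockOp_eq [CompleteSpace H₁] [CompleteSpace H₂] (A₁ : H₁ →L[ℂ] H₁)
    (A₂ : H₂ →L[ℂ] H₂) {X : H₂ →L[ℂ] H₁} (hX : IsFiniteRank X) (F₁ : Submodule ℂ H₁)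
    (F₂ : Submodule ℂ H₂) [FiniteDimensional ℂ F₁] [FiniteDimensional ℂ F₂] :
    ∃ F : Submodule ℂ (WithLp 2 (H₁ × H₂)), FiniteDimensional ℂ F ∧ ∀ v ∈ Fᗮ,
      v.fst ∈ F₁ᗮ ∧ v.snd ∈ F₂ᗮ ∧ blockOp A₁ X (ContinuousLinearMap.adjoint X) A₂ v =
        WithLp.toLp 2 (A₁ v.fst, A₂ v.snd) := by
  have : FiniteDimensional ℂ X.range := hX
  let G₂ := X.range.map (ContinuousLinearMap.adjoint X : H₁ →ₗ[ℂ] H₂)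
  let p := ContinuousLinearMap.adjoint (WithLp.fstL 2 ℂ H₁ H₂)
  let q := ContinuousLinearMap.adjoint (WithLp.sndL 2 ℂ H₁ H₂)
  refine ⟨(F₁ ⊔ X.range).map (p : H₁ →ₗ[ℂ] _) ⊔ (F₂ ⊔ G₂).map (q : H₂ →ₗ[ℂ] _),
    inferInstance, fun v hv => ?_⟩
  rw [← Submodule.inf_orthogonal, Submodule.mem_inf] at hv
  have h1 : v.fst ∈ (F₁ ⊔ X.range)ᗮ := apply_mem_orthogonal (WithLp.fstL 2 ℂ H₁ H₂) hv.1
  have h2 : v.snd ∈ (F₂ ⊔ G₂)ᗮ := apply_mem_orthogonal (WithLp.sndL 2 ℂ H₁ H₂) hv.2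
  rw [← Submodule.inf_orthogonal, Submodule.mem_inf] at h1 h2
  have h3 : ContinuousLinearMap.adjoint X v.fst = 0 := by
    have := h1.2
    rwa [X.orthogonal_range] at this
  have h4 : X v.snd = 0 := by
    have := apply_mem_orthogonal X h2.2
    exact inner_self_eq_zero.1 (this _ ⟨v.snd, rfl⟩)
  exact ⟨h1.1, h2.1, by rw [blockOp_apply, h3, h4, add_zero, zero_add]⟩

theorem IsEssConst.blockOp [CompleteSpace H₁] [CompleteSpace H₂] {A₁ : H₁ →L[ℂ] H₁}
    {A₂ : H₂ →L[ℂ] H₂} {X : H₂ →L[ℂ] H₁} (hX : IsFiniteRank X) {a : ℝ} (h₁ : IsEssConst A₁ a)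
    (h₂ : IsEssConst A₂ a) :
    IsEssConst (blockOp A₁ X (ContinuousLinearMap.adjoint X) A₂) a := by
  refine ⟨fun δ hδ => ?_, ?_⟩
  · obtain ⟨F₁, hF₁, h₁⟩ := h₁.1 δ hδ
    obtain ⟨F₂, hF₂, h₂⟩ := h₂.1 δ hδ
    obtain ⟨F, hF, h⟩ := exists_blockOp_eq A₁ A₂ hX F₁ F₂
    refine ⟨F, hF, fun v hv => ?_⟩
    obtain ⟨hv₁, hv₂, hv⟩ := h v hv
    rw [hv, WithLp.prod_norm_sq_eq_of_L2, WithLp.prod_norm_sq_eq_of_L2, mul_add]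
    exact add_le_add (h₁ _ hv₁) (h₂ _ hv₂)
  · obtain ⟨F₁, hF₁, h₁⟩ := h₁.2
    obtain ⟨F₂, hF₂, h₂⟩ := h₂.2
    obtain ⟨F, hF, h⟩ := exists_blockOp_eq A₁ A₂ hX F₁ F₂
    refine ⟨F, hF, fun v hv => ?_⟩
    obtain ⟨hv₁, hv₂, hv⟩ := h v hv
    rw [hv, WithLp.prod_norm_sq_eq_of_L2, WithLp.prod_norm_sq_eq_of_L2, mul_add]
    exact add_le_add (h₁ _ hv₁) (h₂ _ hv₂)

/-! ### The essential spectrum determines the constant -/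

/-- For positive `A`, the form condition `IsEssConst A a` makes `A - √a` small on complements of
finite-dimensional subspaces. -/
theorem IsEssConst.norm_sub_sqrt_le [CompleteSpace H] {A : H →L[ℂ] H} (hA : A.IsPositive) {a : ℝ}
    (ha : 0 ≤ a) (h : IsEssConst A a) {δ : ℝ} (hδ : 0 < δ) :
    ∃ F : Submodule ℂ H, FiniteDimensional ℂ F ∧
      ∀ x ∈ Fᗮ, ‖A x - (√a : ℂ) • x‖ ^ 2 ≤ δ * ‖x‖ ^ 2 := by
  obtain ⟨F, hF, hFa⟩ := h.1 δ hδ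
  obtain ⟨G, hG, hGa⟩ := h.2
  -- The third summand puts Ax in Gᗮ, so that ‖A(Ax)‖ ≤ √a ‖Ax‖.
  refine ⟨F ⊔ G ⊔ G.map (ContinuousLinearMap.adjoint A : H →ₗ[ℂ] H), inferInstance,
    fun x hx => ?_⟩
  rw [← Submodule.inf_orthogonal, ← Submodule.inf_orthogonal, Submodule.mem_inf,
    Submodule.mem_inf] at hx
  obtain ⟨⟨hxF, hxG⟩, hxA⟩ := hx
  have h1 := hFa x hxF
  have h2 := hGa x hxG
  have h3 := hGa _ (apply_mem_orthogonal A hxA)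
  set b := √a with hb
  have hb0 : 0 ≤ b := Real.sqrt_nonneg a
  have hab : a = b ^ 2 := (Real.sq_sqrt ha).symm
  rw [hab, ← mul_pow, sq_le_sq₀ (norm_nonneg _) (by positivity)] at h2 h3
  rw [hab] at h1
  set t := RCLike.re ⟪A x, x⟫_ℂ with ht
  -- For b > 0, expand ⟪Au, u⟫ ≥ 0 at u = bx - Ax. The estimate then gives ‖Ax - bx‖² ≤ b²‖x‖² -
  -- ‖Ax‖² ≤ δ‖x‖².
  have hkey : ‖A x‖ ^ 2 ≤ b * t := by
    rcases hb0.eq_or_lt with h0 | hpos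
    · rw [← h0, zero_mul] at h2 ⊢
      nlinarith [norm_nonneg (A x)]
    have hp := hA.re_inner_nonneg_left ((b : ℂ) • x - A x)
    have e1 : RCLike.re ⟪A ((b : ℂ) • x - A x), (b : ℂ) • x - A x⟫_ℂ =
        b ^ 2 * t - 2 * b * ‖A x‖ ^ 2 + RCLike.re ⟪A (A x), A x⟫_ℂ := by
      have e2 : ⟪A (A x), x⟫_ℂ = ⟪A x, A x⟫_ℂ := hA.inner_left_eq_inner_right _ _
      simp only [map_sub, map_smul, inner_sub_left, inner_sub_right, inner_smul_left,
        inner_smul_right, e2, inner_self_eq_norm_sq_to_K, Complex.conj_ofReal]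
      simp only [ht]
      norm_cast
      simp [-Complex.ofReal_pow]
      ring
    have h5 : RCLike.re ⟪A (A x), A x⟫_ℂ ≤ b * ‖A x‖ ^ 2 :=
      (re_inner_le_norm _ _).trans (by nlinarith [norm_nonneg (A x)])
    rw [e1] at hp
    have : b * ‖A x‖ ^ 2 ≤ b * (b * t) := by linarith
    exact le_of_mul_le_mul_left this hpos
  rw [@norm_sub_sq ℂ, inner_smul_right, norm_smul, Complex.norm_real, Real.norm_of_nonneg hb0]
  have e3 : RCLike.re ((b : ℂ) * ⟪A x, x⟫_ℂ) = b * t := RCLike.re_ofReal_mul _ _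
  rw [e3, mul_pow]
  linarith

theorem sqrt_mem_essSpectrum [CompleteSpace H] (hH : ¬ FiniteDimensional ℂ H) {A : H →L[ℂ] H}
    (hA : A.IsPositive) {a : ℝ} (ha : 0 ≤ a) (h : IsEssConst A a) :
    (√a : ℂ) ∈ essSpectrum A := by
  intro hfred
  set S := A - (√a : ℂ) • ContinuousLinearMap.id ℂ H
  have : CompleteSpace S.range := hfred.isClosed_range.completeSpace_coe
  have : FiniteDimensional ℂ S.ker := hfred.finite_ker
  obtain ⟨C, hC, hCS⟩ := S.rangeRestrict.exists_preimage_norm_le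
    (LinearMap.surjective_rangeRestrict _)
  -- A unit x ⟂ ker S is the shortest preimage of Sx, so ‖y‖ ≥ 1, whereas this δ forces ‖y‖² ≤ 1/2.
  obtain ⟨F, hF, hFa⟩ := h.norm_sub_sqrt_le hA ha (δ := 1 / (2 * C ^ 2)) (by positivity)
  obtain ⟨x, hx, hx1⟩ := exists_unit_mem_orthogonal hH (F ⊔ S.ker)
  rw [← Submodule.inf_orthogonal, Submodule.mem_inf] at hx
  obtain ⟨y, hy, hyC⟩ := hCS (S.rangeRestrict x)
  have hy' : S y = S x := congrArg Subtype.val hy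
  have hyC' : ‖y‖ ≤ C * ‖S x‖ := hyC
  have hker : y - x ∈ S.ker := by simp [hy']
  have hpyth := norm_add_sq_eq_norm_sq_add_norm_sq_of_inner_eq_zero (𝕜 := ℂ) _ _ (hx.2 _ hker)
  rw [sub_add_cancel, hx1] at hpyth
  have h1 : ‖S x‖ ^ 2 ≤ 1 / (2 * C ^ 2) * ‖x‖ ^ 2 := hFa x hx.1
  rw [hx1, one_pow, mul_one, le_div_iff₀ (by positivity)] at h1
  have h2 : ‖y‖ ^ 2 ≤ (C * ‖S x‖) ^ 2 := pow_le_pow_left₀ (norm_nonneg _) hyC' 2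
  rw [mul_pow] at h2
  nlinarith [mul_self_nonneg ‖y - x‖]

/-- The kernel meets Fᗮ trivially, hence embeds in F; S(Fᗮ) is closed and Fᗮ has finite codimension,
so the range is closed. Self-adjointness handles the cokernel. -/
theorem isFredholm_of_bound [CompleteSpace H] {S : H →L[ℂ] H} (hS : IsSelfAdjoint S)
    (F : Submodule ℂ H) [FiniteDimensional ℂ F] {c : ℝ} (hc : 0 < c)
    (h : ∀ x ∈ Fᗮ, c * ‖x‖ ≤ ‖S x‖) : S.IsFredholm := by
  have hker : FiniteDimensional ℂ S.ker := by
    refine FiniteDimensional.of_injective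
      ((F.orthogonalProjectionOnto : H →ₗ[ℂ] F) ∘ₗ S.ker.subtype) ?_
    rw [← LinearMap.ker_eq_bot, LinearMap.ker_eq_bot']
    rintro ⟨k, hk⟩ hk0
    have h1 : k ∈ Fᗮ := by
      simpa using hk0
    have h2 := h k h1
    have hk' : S k = 0 := hk
    rw [hk', norm_zero] at h2
    have : ‖k‖ = 0 := le_antisymm (by nlinarith) (norm_nonneg _)
    simpa using this
  rw [isFredholm_iff, hS.adjoint_eq]
  refine ⟨?_, hker, hker⟩
  have : Fᗮ.CoFG := Module.Finite.equiv
    (Submodule.quotientEquivOfIsCompl Fᗮ F (Submodule.isCompl_orthogonal F).symm).symm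
  refine LinearMap.isClosed_range_of_isClosed_map_of_finiteDimensional_quotient (s := Fᗮ) ?_
  have hanti : AntilipschitzWith ⟨c⁻¹, by positivity⟩ (S ∘L Fᗮ.subtypeL) :=
    ContinuousLinearMap.antilipschitz_of_bound _ fun x => by
      have := h x x.2
      change ‖(x : H)‖ ≤ c⁻¹ * ‖S x‖
      rwa [le_inv_mul_iff₀ hc]
  convert hanti.isClosed_range (S ∘L Fᗮ.subtypeL).uniformContinuous using 1
  ext y
  simp

/-- If μ ≠ √a, then A - μ is within |μ - √a|/2 of the scalar √a - μ on a large subspace, hence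
bounded below there. Real μ keeps A - μ self-adjoint. -/
theorem eq_sqrt_of_mem_essSpectrum [CompleteSpace H] {A : H →L[ℂ] H} (hA : A.IsPositive) {a : ℝ}
    (ha : 0 ≤ a) (h : IsEssConst A a) {μ : ℝ} (hμ : (μ : ℂ) ∈ essSpectrum A) : μ = √a := by
  by_contra hne
  have hpos : 0 < |μ - √a| := abs_pos.2 (sub_ne_zero.2 hne)
  obtain ⟨F, hF, hFa⟩ := h.norm_sub_sqrt_le hA ha (δ := (|μ - √a| / 2) ^ 2) (by positivity)
  refine hμ (isFredholm_of_bound ?_ F (half_pos hpos) fun x hx => ?_)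
  · refine hA.isSelfAdjoint.sub (IsSelfAdjoint.smul ?_ (IsSelfAdjoint.one (H →L[ℂ] H)))
    exact Complex.conj_ofReal μ
  · have h1 := hFa x hx
    rw [← mul_pow, sq_le_sq₀ (norm_nonneg _) (by positivity)] at h1
    have h2 : ‖((μ - √a : ℝ) : ℂ) • x‖ ≤ ‖A x - (√a : ℂ) • x‖ + ‖A x - (μ : ℂ) • x‖ := by
      refine le_trans (le_of_eq ?_) (norm_sub_le _ _)
      congr 1
      rw [Complex.ofReal_sub, sub_smul]
      abel
    rw [norm_smul, Complex.norm_real, Real.norm_eq_abs] at h2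
    change _ ≤ ‖A x - (μ : ℂ) • x‖
    linarith

theorem essSpectrum_eq_empty [CompleteSpace H] [FiniteDimensional ℂ H] (A : H →L[ℂ] H) :
    essSpectrum A = ∅ := by
  refine Set.eq_empty_of_forall_notMem fun μ hμ => hμ ?_
  rw [isFredholm_iff]
  exact ⟨Submodule.closed_of_finiteDimensional _, inferInstance, inferInstance⟩

theorem finiteDimensional_of_essSpectrum_eq_empty [CompleteSpace H] {A : H →L[ℂ] H}
    (hA : A.IsPositive) (hAM : IsAM A) (h : essSpectrum A = ∅) : FiniteDimensional ℂ H := by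
  by_contra hH
  obtain ⟨a, ha, hess⟩ := hAM.exists_isEssConst hH
  have := sqrt_mem_essSpectrum hH hA ha hess
  simp [h] at this

/-- An empty essential spectrum detects finite dimension, where every constant works; otherwise √a
lies in both spectra. -/
theorem exists_common_isEssConst [CompleteSpace H₁] [CompleteSpace H₂] {A₁ : H₁ →L[ℂ] H₁}
    {A₂ : H₂ →L[ℂ] H₂} (hA₁ : A₁.IsPositive) (hA₂ : A₂.IsPositive) (hAM₁ : IsAM A₁)
    (hAM₂ : IsAM A₂) (hess : essSpectrum A₁ = essSpectrum A₂) :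
    ∃ a, IsEssConst A₁ a ∧ IsEssConst A₂ a := by
  by_cases hfin : FiniteDimensional ℂ H₁
  · have : FiniteDimensional ℂ H₂ := finiteDimensional_of_essSpectrum_eq_empty hA₂ hAM₂
      (hess ▸ essSpectrum_eq_empty A₁)
    exact ⟨0, isEssConst_of_finiteDimensional _ _, isEssConst_of_finiteDimensional _ _⟩
  · obtain ⟨a, ha, h₁⟩ := hAM₁.exists_isEssConst hfin
    have hmem := sqrt_mem_essSpectrum hfin hA₁ ha h₁
    have hfin₂ : ¬ FiniteDimensional ℂ H₂ := by
      intro hfin₂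
      rw [hess, essSpectrum_eq_empty] at hmem
      exact hmem
    obtain ⟨b, hb, h₂⟩ := hAM₂.exists_isEssConst hfin₂
    have hab : a = b := (Real.sqrt_inj ha hb).1
      (eq_sqrt_of_mem_essSpectrum hA₂ hb h₂ (hess ▸ hmem))
    exact ⟨a, h₁, hab ▸ h₂⟩

end BlockAM

theorem mainTheorem6 {H₁ H₂ : Type*}
    [NormedAddCommGroup H₁] [InnerProductSpace ℂ H₁] [CompleteSpace H₁]
    [NormedAddCommGroup H₂] [InnerProductSpace ℂ H₂] [CompleteSpace H₂]
    (A₁ : H₁ →L[ℂ] H₁) (A₂ : H₂ →L[ℂ] H₂) (X : H₂ →L[ℂ] H₁)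
    (hA₁ : A₁.IsPositive) (hA₂ : A₂.IsPositive)
    (hT : (BlockAM.blockOp A₁ X (ContinuousLinearMap.adjoint X) A₂).IsPositive)
    (hAM₁ : BlockAM.IsAM A₁) (hAM₂ : BlockAM.IsAM A₂)
    (hess : BlockAM.essSpectrum A₁ = BlockAM.essSpectrum A₂)
    (hX : BlockAM.IsFiniteRank X) :
    BlockAM.IsAM (BlockAM.blockOp A₁ X (ContinuousLinearMap.adjoint X) A₂) := by
  obtain ⟨a, h₁, h₂⟩ := BlockAM.exists_common_isEssConst hA₁ hA₂ hAM₁ hAM₂ hess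
  exact (h₁.blockOp hX h₂).isAM
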